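/- Let $\mathcal B$ be a separable complex Banach space, $\mathcal B^*$ the Banach space of bounded anti-linear functionals on $\mathcal B$, and write $\langle b_*,b\rangle=b_*(b)$. For $A\in\mathbf L(\mathcal B,\mathcal B^*)$ let $A^*|_{\mathcal B}\in\mathbf L(\mathcal B,\mathcal B^*)$ be the restriction to $\mathcal B\subset\mathcal B^{**}$ of the adjoint of $A$, that is, $\langle A^*|_{\mathcal B}\,b,c\rangle=\overline{\langle Ac,b\rangle}$; write $A\ge 0$ if $\langle Ab,b\rangle\ge 0$ for all $b\in\mathcal B$. Let $\mathbb D$ be the open unit disk. For a function $\phi$ with values in $\mathbf L(\mathcal B,\mathcal B^*)$ put $$k_\phi(z,w)=\frac{\phi(z)+\phi(w)^*|_{\mathcal B}}{2(1-z\overline w)} .$$ A kernel $K$ is called positive on $\Omega$ if $\sum_{i,j=1}^n\langle K(z_i,z_j)b_j,b_i\rangle\ge 0$ for all $n$, all $z_1,\dots,z_n\in\Omega$ and all $b_1,\dots,b_n\in\mathcal B$. If $\Omega\subset\mathbb D$ is a neighborhood of the origin, $\phi:\Omega\to\mathbf L(\mathcal B,\mathcal B^*)$ is called a Carathéodory function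 on $\Omega$ if $\langle\phi(z)b,b\rangle\to\langle\phi(0)b,b\rangle$ as $z\to0$ for every $b\in\mathcal B$ and $k_\phi$ is positive on $\Omega$. 1. Let $\phi:\mathbb D\to\mathbf L(\mathcal B,\mathcal B^*)$ be analytic with $\phi(z)+\phi(z)^*|_{\mathcal B}\ge 0$ for all $z\in\mathbb D$. Then there exist $M:[0,2\pi]\to\mathbf L(\mathcal B,\mathcal B^*)$ which is positive and increasing ($M(t)\ge0$ for all $t$, and $M(t)-M(s)\ge 0$ for $s\le t$) and $D\in\mathbf L(\mathcal B,\mathcal B^*)$ which is purely imaginary ($D+D^*|_{\mathcal B}=0$) such that $$\phi(z)=D+\int_0^{2\pi}\frac{e^{it}+z}{e^{it}-z}\,dM(t),\qquad z\in\mathbb D,$$ where the integral is taken in the weak sense: for all $x,y\in\mathcal B$ the Stieltjes sums $\sum_j f(\xi_j)\langle (M(t_j)-M(t_{j-1}))x,y\rangle$ for $f(t)=\frac{e^{it}+z}{e^{it}-z}$, with $t_{j-1}\le\xi_j\le t_j$, converge to $\langle(\phi(z)-D)x,y\rangle$ as the mesh of the subdivision $0=t_0\le\dots\le t_m=2\pi$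 tends to $0$. Moreover, $k_\phi$ is positive on $\mathbb D$. 2. Such functions are exactly the Carathéodory functions: a function $\phi:\mathbb D\to\mathbf L(\mathcal B,\mathcal B^*)$ is analytic with $\phi(z)+\phi(z)^*|_{\mathcal B}\ge0$ on $\mathbb D$ if and only if it is a Carathéodory function on $\mathbb D$. More generally, for any neighborhood $\Omega\subset\mathbb D$ of the origin, a function $\phi:\Omega\to\mathbf L(\mathcal B,\mathcal B^*)$ is a Carathéodory function on $\Omega$ if and only if it is the restriction to $\Omega$ of an analytic function $\Phi:\mathbb D\to\mathbf L(\mathcal B,\mathcal B^*)$ with $\Phi(z)+\Phi(z)^*|_{\mathcal B}\ge0$ on $\mathbb D$. -/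

import Mathlib

open scoped ComplexOrder Topology ComplexConjugate

namespace HerglotzBanach

noncomputable section

/-- The conjugate dual `E*`: bounded anti-linear functionals, with the operator norm. -/
abbrev AntiDual (E : Type*) [NormedAddCommGroup E] [NormedSpace ℂ E] : Type _ :=
  E →L⋆[ℂ] ℂ

/-- `L(B, B*)`; the duality `⟨A b, c⟩` is written `A b c`. -/
abbrev Op (B : Type*) [NormedAddCommGroup B] [NormedSpace ℂ B] : Type _ :=
  B →L[ℂ] AntiDual B

section Adjoint

variable {E F B : Type*} [NormedAddCommGroup E] [NormedSpace ℂ E]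
  [NormedAddCommGroup F] [NormedSpace ℂ F] [NormedAddCommGroup B] [NormedSpace ℂ B]

/-- The Banach space adjoint `A* : F* → E*` of `A : E → F`, `⟨A* g, x⟩ = ⟨g, A x⟩`. -/
def adj (A : E →L[ℂ] F) : AntiDual F →L[ℂ] AntiDual E :=
  LinearMap.mkContinuous
    { toFun := fun g => g.comp A
      map_add' := fun _ _ => rfl
      map_smul' := fun _ _ => rfl } ‖A‖
    (fun g => (g.opNorm_comp_le A).trans_eq (mul_comm _ _))

theorem adj_apply (A : E →L[ℂ] F) (g : AntiDual F) (x : E) : adj A g x = g (A x) := rfl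

/-- The functional `f ↦ conj ⟨f, b⟩` on `B*`, an element of `B**`. -/
def tauFun (b : B) : AntiDual (AntiDual B) :=
  LinearMap.mkContinuous
    { toFun := fun f : AntiDual B => conj (f b)
      map_add' := fun f g => by simp
      map_smul' := fun c f => by simp } ‖b‖
    (fun f => by simpa [mul_comm] using f.le_opNorm b)

theorem tauFun_norm_le (b : B) : ‖tauFun b‖ ≤ ‖b‖ :=
  LinearMap.mkContinuous_norm_le _ (norm_nonneg b) _

/-- The natural injection `τ : B → B**`, `⟨τ b, f⟩ = conj ⟨f, b⟩`. -/
def tau (B : Type*) [NormedAddCommGroup B] [NormedSpace ℂ B] :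
    B →L[ℂ] AntiDual (AntiDual B) :=
  LinearMap.mkContinuous
    { toFun := tauFun
      map_add' := fun b c => by ext f; simp [tauFun]
      map_smul' := fun a b => by ext f; simp [tauFun] } 1
    (fun b => (tauFun_norm_le b).trans_eq (one_mul _).symm)

theorem tau_apply (b : B) (f : AntiDual B) : tau B b f = conj (f b) := rfl

/-- `A*|_B`, the adjoint `A* : B** → B*` of `A : B → B*` restricted to `B` along `τ`. -/
def adjB (A : Op B) : Op B := (adj A).comp (tau B)

theorem adjB_apply (A : Op B) (b c : B) : adjB A b c = conj (A c b) := rfl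

end Adjoint

variable {B : Type*} [NormedAddCommGroup B] [NormedSpace ℂ B]

/-- `A ≥ 0`: every `⟨A b, b⟩` is a nonnegative real number (order of `ℂ`). -/
def IsPositiveOp (A : Op B) : Prop := ∀ b : B, 0 ≤ A b b

/-- `D` is purely imaginary: `D + D*|_B = 0`. -/
def IsPurelyImaginary (D : Op B) : Prop := D + adjB D = 0

/-- An increasing positive `L(B, B*)`-valued function on `[a, b]`. -/
structure IsIncreasingPositiveOn (M : ℝ → Op B) (a b : ℝ) : Prop where
  pos : ∀ t ∈ Set.Icc a b, IsPositiveOp (M t)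
  incr : ∀ s ∈ Set.Icc a b, ∀ t ∈ Set.Icc a b, s ≤ t → IsPositiveOp (M t - M s)

/-- `J = ∫_a^b f dM` in the weak sense: for all `x, y`, the Stieltjes sums
`∑ f(ξ_j) ⟨(M(t_{j+1}) - M(t_j)) x, y⟩` converge to `⟨J x, y⟩` as the mesh of the tagged
subdivision of `[a, b]` tends to `0`. -/
def HasWeakStieltjesIntegral (f : ℝ → ℂ) (M : ℝ → Op B) (a b : ℝ) (J : Op B) : Prop :=
  ∀ x y : B, ∀ ε : ℝ, 0 < ε → ∃ δ : ℝ, 0 < δ ∧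
    ∀ (m : ℕ) (t ξ : ℕ → ℝ), t 0 = a → t m = b →
      (∀ j < m, t j ≤ ξ j ∧ ξ j ≤ t (j + 1) ∧ t (j + 1) - t j ≤ δ) →
      ‖(∑ j ∈ Finset.range m, f (ξ j) * (M (t (j + 1)) - M (t j)) x y) - J x y‖ < ε

/-- The kernel `k_φ(z, w) = (φ(z) + φ(w)*|_B) / (2 (1 - z w*))`. -/
def kernel (φ : ℂ → Op B) (z w : ℂ) : Op B :=
  (2 * (1 - z * conj w))⁻¹ • (φ z + adjB (φ w))

/-- Positivity on `Ω` of an `L(B, B*)`-valued kernel: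
`∑_{i,j} ⟨K(z_i, z_j) b_j, b_i⟩ ≥ 0` for all finite families. -/
def IsPositiveKernelOn (K : ℂ → ℂ → Op B) (Ω : Set ℂ) : Prop :=
  ∀ (n : ℕ) (z : Fin n → ℂ) (b : Fin n → B), (∀ i, z i ∈ Ω) →
    0 ≤ ∑ i, ∑ j, K (z i) (z j) (b j) (b i)

/-- A Carathéodory function on a neighbourhood `Ω` of the origin: weakly continuous at the
origin, with positive kernel `k_φ` on `Ω`. -/
structure IsCaratheodoryOn (φ : ℂ → Op B) (Ω : Set ℂ) : Prop where
  weakCont : ∀ b : B, Filter.Tendsto (fun z => φ z b b) (𝓝[Ω] 0) (𝓝 (φ 0 b b))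
  posKernel : IsPositiveKernelOn (kernel φ) Ω

/-- `φ` is analytic (in operator norm) in the open unit disk and
`φ(z) + φ(z)*|_B ≥ 0` there. -/
structure IsAnalyticPosRealPart (φ : ℂ → Op B) : Prop where
  analytic : AnalyticOnNhd ℂ φ (Metric.ball 0 1)
  posReal : ∀ z ∈ Metric.ball (0 : ℂ) 1, IsPositiveOp (φ z + adjB (φ z))

end

end HerglotzBanach

/-! Everything is tested on pairs of vectors, which reduces operator statements to scalar ones;
positivity of an operator supplies the estimates, through Cauchy–Schwarz.

From analytic to integral and kernel: the dilations `φ (r * ζ)`, `r < 1`, are continuous up to the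
circle. Cauchy's formula against the product of two Szegő kernels writes `kernel` as an average over
the circle of positive quadratic forms, and `r → 1` gives `IsAnalyticPosRealPart.posKernel`. The
Schwarz formula recovers a dilation from its real part, up to the constant `D`. The indefinite
integrals of these real parts are increasing in `t` with total mass `Re φ(0)` for every `r`, so they
have a weak limit `M` along an ultrafilter. The error of a Stieltjes sum is bounded uniformly in
`r`, hence the representation survives the limit (`exists_herglotz`).

From kernel to analytic (`IsPositiveKernelOn.exists_extension`): factor the kernel K as inner
products of vectors `v z b` in a Hilbert space. The identity K(z,w) − K(z,0) − K(0,w) + K(0,0) = z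
w̄ K(z,w) says that z̄ v_z ↦ v_z − v_0 is isometric, so it extends to a contraction V with v_z = (1
− z̄V)⁻¹ v_0. Since φ(z) = 2K(z,0) − φ(0)*, the function φ is a transfer function built from V*,
which is defined and analytic on the whole disk. -/

open scoped ComplexOrder Topology ComplexConjugate InnerProductSpace

namespace HerglotzBanach

universe u

/-! ### Positive operators from a Banach space to its conjugate dual -/

section Positivity

variable {B : Type*} [NormedAddCommGroup B] [NormedSpace ℂ B]

/-- The evaluation `A ↦ ⟨A x, y⟩`. -/
noncomputable def evalCLM (x y : B) : Op B →L[ℂ] ℂ :=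
  (ContinuousLinearMap.apply' ℂ (starRingEnd ℂ) y).comp
    (ContinuousLinearMap.apply ℂ (AntiDual B) x)

theorem isPositiveOp_iff_re_im {P : Op B} :
    IsPositiveOp P ↔ ∀ b, 0 ≤ (P b b).re ∧ (P b b).im = 0 := by
  simp only [IsPositiveOp, Complex.nonneg_iff, eq_comm]

/-- A positive operator is Hermitian. -/
theorem IsPositiveOp.conj_apply {P : Op B} (hP : IsPositiveOp P) (x y : B) :
    conj (P y x) = P x y := by
  have him : ∀ b, (P b b).im = 0 := fun b => (isPositiveOp_iff_re_im.1 hP b).2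
  have h1 := him (x + y)
  have h2 := him (x + Complex.I • y)
  have hx := him x
  have hy := him y
  simp [hx, hy] at h1 h2
  apply Complex.ext <;> simp <;> linarith

/-- Expand `P (x - c • y) (x - c • y) ≥ 0` with `c` the phase of `P x y`. This additive form of
Cauchy–Schwarz, unlike the product form, can be integrated and summed termwise. -/
theorem IsPositiveOp.two_mul_norm_apply_le {P : Op B} (hP : IsPositiveOp P) (x y : B) :
    2 * ‖P x y‖ ≤ (P x x).re + (P y y).re := by
  rcases eq_or_ne (P x y) 0 with h | h
  · simpa [h] using add_nonneg (isPositiveOp_iff_re_im.1 hP x).1 (isPositiveOp_iff_re_im.1 hP y).1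
  set c : ℂ := P x y / ‖P x y‖ with hc
  have hn : (‖P x y‖ : ℂ) ≠ 0 := by simpa using h
  have hcP : conj c * P x y = ‖P x y‖ := by
    rw [hc, map_div₀, Complex.conj_ofReal, div_mul_eq_mul_div, mul_comm, Complex.mul_conj,
      Complex.normSq_eq_norm_sq]
    push_cast
    field_simp
  have hcP' : c * P y x = ‖P x y‖ := by
    have := congrArg conj hcP
    rwa [map_mul, Complex.conj_conj, hP.conj_apply, Complex.conj_ofReal] at this
  have hcc : c * conj c = 1 := by
    rw [Complex.mul_conj, Complex.normSq_eq_norm_sq, hc, norm_div, Complex.norm_real, norm_norm,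
      div_self (by simpa using h)]
    simp
  have key := (isPositiveOp_iff_re_im.1 hP (x - c • y)).1
  have : P (x - c • y) (x - c • y) = P x x + P y y - 2 * ‖P x y‖ := by
    simp only [map_sub, map_smul, map_smulₛₗ, sub_apply, smul_apply, smul_eq_mul]
    linear_combination P y y * hcc - hcP - hcP'
  rw [this] at key
  simp at key
  linarith

/-- Homogeneity: the hypothesis at the normalized vectors gives the product bound. -/
theorem norm_apply_le_of_two_mul_norm_apply_le {P : Op B} {C : ℝ}
    (h : ∀ x y, 2 * ‖P x y‖ ≤ C * ‖x‖ ^ 2 + C * ‖y‖ ^ 2) (x y : B) :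
    ‖P x y‖ ≤ C * ‖x‖ * ‖y‖ := by
  rcases eq_or_ne x 0 with rfl | hx
  · simp
  rcases eq_or_ne y 0 with rfl | hy
  · simp
  have hx' := norm_pos_iff.2 hx
  have hy' := norm_pos_iff.2 hy
  have := h ((‖x‖⁻¹ : ℂ) • x) ((‖y‖⁻¹ : ℂ) • y)
  simp [norm_smul, hx'.ne', hy'.ne'] at this
  have h2 : ‖x‖⁻¹ * ‖P x y‖ * ‖y‖⁻¹ ≤ C := by linarith
  calc ‖P x y‖ = (‖x‖⁻¹ * ‖P x y‖ * ‖y‖⁻¹) * ‖x‖ * ‖y‖ := by field_simp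
    _ ≤ _ := by gcongr

theorem IsPositiveOp.norm_le {P : Op B} (hP : IsPositiveOp P) {C : ℝ} (hC : 0 ≤ C)
    (h : ∀ x, (P x x).re ≤ C * ‖x‖ ^ 2) : ‖P‖ ≤ C :=
  ContinuousLinearMap.opNorm_le_bound₂ _ hC fun x y =>
    norm_apply_le_of_two_mul_norm_apply_le
      (fun x y => (hP.two_mul_norm_apply_le x y).trans (add_le_add (h x) (h y))) x y

/-- A bounded family of operators converges weakly along an ultrafilter. -/
theorem exists_tendsto_apply_of_norm_le {ι : Type*} (U : Ultrafilter ι) (F : ι → Op B) {C : ℝ}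
    (hF : ∀ᶠ i in U, ‖F i‖ ≤ C) :
    ∃ A : Op B, ∀ x y, Filter.Tendsto (fun i => F i x y) U (𝓝 (A x y)) := by
  have hb : ∀ x y, ∀ᶠ i in U, ‖F i x y‖ ≤ C * ‖x‖ * ‖y‖ := fun x y => hF.mono fun i hi =>
    ((F i).le_opNorm₂ x y).trans (by gcongr)
  -- Each scalar family eventually stays in a compact disk, so it converges along the ultrafilter;
  -- sesquilinearity and the bound `C` then pass to the limit.
  have hlim : ∀ x y, ∃ a : ℂ, Filter.Tendsto (fun i => F i x y) U (𝓝 a) := fun x y => by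
    obtain ⟨a, -, ha⟩ := (isCompact_closedBall (0 : ℂ) (C * ‖x‖ * ‖y‖)).ultrafilter_le_nhds
      (U.map fun i => F i x y) (by
        rw [Filter.le_principal_iff]
        exact (hb x y).mono fun i hi => by simpa using hi)
    exact ⟨a, ha⟩
  choose a ha using hlim
  refine ⟨LinearMap.mkContinuous₂ (LinearMap.mk₂'ₛₗ (RingHom.id ℂ) (starRingEnd ℂ) a ?_ ?_ ?_ ?_) C
    fun x y => le_of_tendsto (ha x y).norm (hb x y), ha⟩
  · exact fun x x' y => tendsto_nhds_unique (ha _ _)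
      (((ha x y).add (ha x' y)).congr fun i => by simp)
  · exact fun c x y => tendsto_nhds_unique (ha _ _)
      (((ha x y).const_smul c).congr fun i => by simp)
  · exact fun x y y' => tendsto_nhds_unique (ha _ _)
      (((ha x y).add (ha x y')).congr fun i => by simp)
  · exact fun c x y => tendsto_nhds_unique (ha _ _)
      (((ha x y).const_smul (conj c)).congr fun i => by simp)

end Positivity

/-! ### Cauchy and Schwarz formulas on the unit circle -/

section CircleAverage

open Real (circleAverage)

theorem circleAverage_nonneg {f : ℂ → ℂ} (hf : ∀ ζ ∈ Metric.sphere (0 : ℂ) 1, 0 ≤ f ζ) :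
    0 ≤ circleAverage f 0 1 := by
  have h : circleAverage f 0 1 = (circleAverage (fun ζ => (f ζ).re) 0 1 : ℝ) := by
    rw [Real.circleAverage_congr_sphere (f₂ := fun ζ => ((f ζ).re : ℂ))]
    · simp [circleAverage, intervalIntegral.integral_ofReal]
    · intro ζ hζ
      rw [abs_one] at hζ
      exact Complex.ext (by simp) (by simpa using (Complex.nonneg_iff.1 (hf ζ hζ)).2.symm)
  rw [h]
  exact Complex.zero_le_real.2 (Real.circleAverage_nonneg_of_nonneg fun ζ hζ =>
    (Complex.nonneg_iff.1 (hf ζ (by simpa using hζ))).1)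

theorem circleAverage_conj (f : ℂ → ℂ) (c : ℂ) (R : ℝ) :
    circleAverage (fun ζ => conj (f ζ)) c R = conj (circleAverage f c R) := by
  simp only [circleAverage, intervalIntegral.intervalIntegral_eq_integral_uIoc, integral_conj,
    Complex.real_smul, map_mul, Complex.conj_ofReal]

theorem one_sub_mul_conj_ne_zero {z w : ℂ} (hz : ‖z‖ < 1) (hw : ‖w‖ ≤ 1) : 1 - z * conj w ≠ 0 := by
  intro h
  have : ‖z * conj w‖ = 1 := by rw [← sub_eq_zero.1 h, norm_one]
  rw [norm_mul, RCLike.norm_conj] at this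
  nlinarith [norm_nonneg z, norm_nonneg w]

theorem one_sub_conj_mul_ne_zero {z w : ℂ} (hz : ‖z‖ ≤ 1) (hw : ‖w‖ < 1) : 1 - conj w * z ≠ 0 := by
  have := one_sub_mul_conj_ne_zero (z := conj w) (w := conj z) (by simpa) (by simpa)
  simpa using this

/-- On the circle ζ̄ = ζ⁻¹, so (1 − zζ̄)⁻¹ is the Cauchy kernel ζ/(ζ − z). It reproduces at z the
function (1 − w̄ζ)⁻¹ g(ζ), which is analytic in the disk. -/
theorem circleAverage_szego_mul {g : ℂ → ℂ} (hg : DiffContOnCl ℂ g (Metric.ball 0 1)) {z w : ℂ}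
    (hz : ‖z‖ < 1) (hw : ‖w‖ < 1) :
    circleAverage (fun ζ => (1 - z * conj ζ)⁻¹ * (1 - conj w * ζ)⁻¹ * g ζ) 0 1 =
      (1 - z * conj w)⁻¹ * g z := by
  have hd : DiffContOnCl ℂ (fun ζ => (1 - conj w * ζ)⁻¹ * g ζ) (Metric.ball 0 1) := by
    refine DiffContOnCl.smul (c := fun ζ => (1 - conj w * ζ)⁻¹) ?_ hg
    refine DiffContOnCl.inv (Differentiable.diffContOnCl (by fun_prop)) fun ζ hζ => ?_
    exact one_sub_conj_mul_ne_zero (by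
      rw [closure_ball _ one_ne_zero] at hζ; simpa using hζ) hw
  have := DiffContOnCl.circleAverage_smul_div (R := 1) (c := 0) (w := z)
    (by rwa [abs_one]) (by simpa using hz)
  rw [mul_comm z, ← this]
  refine Real.circleAverage_congr_sphere fun ζ hζ => ?_
  have hζ' : ‖ζ‖ = 1 := by simpa using hζ
  have hc : conj ζ = ζ⁻¹ := (Complex.inv_eq_conj hζ').symm
  have h0 : ζ ≠ 0 := by rintro rfl; simp at hζ'
  have hne : ζ - z ≠ 0 := by
    intro h; rw [sub_eq_zero.1 h] at hζ'; exact hz.ne hζ'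
  have : (1 - z * conj ζ)⁻¹ = ζ / (ζ - z) := by
    rw [hc, inv_eq_iff_eq_inv, inv_div]; field_simp
  simp only [this, sub_zero, smul_eq_mul, mul_assoc]

theorem circleIntegrable_szego_mul {g : ℂ → ℂ} (hg : ContinuousOn g (Metric.sphere 0 1)) {z w : ℂ}
    (hz : ‖z‖ < 1) (hw : ‖w‖ < 1) :
    CircleIntegrable (fun ζ => (1 - z * conj ζ)⁻¹ * (1 - conj w * ζ)⁻¹ * g ζ) 0 1 := by
  refine ContinuousOn.circleIntegrable zero_le_one (ContinuousOn.mul (ContinuousOn.mul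
    (ContinuousOn.inv₀ ?_ ?_) (ContinuousOn.inv₀ (by fun_prop) ?_)) hg)
  · exact (continuous_const.sub (continuous_const.mul Complex.continuous_conj)).continuousOn
  · exact fun ζ hζ => one_sub_mul_conj_ne_zero hz (by simpa using hζ.le)
  · exact fun ζ hζ => one_sub_conj_mul_ne_zero (by simpa using hζ.le) hw

theorem _root_.DiffContOnCl.continuousOn_sphere {g : ℂ → ℂ}
    (hg : DiffContOnCl ℂ g (Metric.ball 0 1)) : ContinuousOn g (Metric.sphere 0 1) :=
  hg.continuousOn.mono (by
    rw [closure_ball _ one_ne_zero]; exact Metric.sphere_subset_closedBall)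

/-- The Cauchy formula for the sum of an analytic and an anti-analytic function. -/
theorem circleAverage_szego_mul_add_conj {g h : ℂ → ℂ} (hg : DiffContOnCl ℂ g (Metric.ball 0 1))
    (hh : DiffContOnCl ℂ h (Metric.ball 0 1)) {z w : ℂ} (hz : ‖z‖ < 1) (hw : ‖w‖ < 1) :
    circleAverage (fun ζ => (1 - z * conj ζ)⁻¹ * (1 - conj w * ζ)⁻¹ * (g ζ + conj (h ζ))) 0 1 =
      (1 - z * conj w)⁻¹ * (g z + conj (h w)) := by
  -- The anti-analytic half is the conjugate of the analytic formula with z and w exchanged.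
  have h2 := circleAverage_conj (fun ζ => (1 - w * conj ζ)⁻¹ * (1 - conj z * ζ)⁻¹ * h ζ) 0 1
  rw [circleAverage_szego_mul hh hw hz] at h2
  have h3 : (fun ζ => conj ((1 - w * conj ζ)⁻¹ * (1 - conj z * ζ)⁻¹ * h ζ)) =
      fun ζ => (1 - z * conj ζ)⁻¹ * (1 - conj w * ζ)⁻¹ * conj (h ζ) := by
    ext ζ
    simp only [map_mul, map_inv₀, map_sub, map_one, Complex.conj_conj]
    ring
  rw [h3] at h2
  have hi : CircleIntegrable (fun ζ => (1 - z * conj ζ)⁻¹ * (1 - conj w * ζ)⁻¹ * conj (h ζ)) 0 1 :=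
    circleIntegrable_szego_mul (Complex.continuous_conj.comp_continuousOn hh.continuousOn_sphere)
      hz hw
  simp_rw [mul_add]
  rw [Real.circleAverage_fun_add (circleIntegrable_szego_mul hg.continuousOn_sphere hz hw) hi, h2,
    circleAverage_szego_mul hg hz hw]
  simp only [map_mul, map_inv₀, map_sub, map_one, Complex.conj_conj]
  ring

/-- The Schwarz formula. -/
theorem circleAverage_herglotz_mul_add_conj {g h : ℂ → ℂ}
    (hg : DiffContOnCl ℂ g (Metric.ball 0 1)) (hh : DiffContOnCl ℂ h (Metric.ball 0 1)) {z : ℂ}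
    (hz : ‖z‖ < 1) :
    circleAverage (fun ζ => (ζ + z) / (ζ - z) * (g ζ + conj (h ζ))) 0 1 =
      2 * g z - g 0 + conj (h 0) := by
  -- On the circle (ζ + z)/(ζ − z) = 2(1 − zζ̄)⁻¹ − 1, so the result is twice the formula at (z, 0)
  -- minus the one at (0, 0).
  have h1 := circleAverage_szego_mul_add_conj hg hh hz (w := 0) (by simp)
  have h0 := circleAverage_szego_mul_add_conj hg hh (z := 0) (w := 0) (by simp) (by simp)
  have hc : ContinuousOn (fun ζ => g ζ + conj (h ζ)) (Metric.sphere 0 1) :=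
    hg.continuousOn_sphere.add (Complex.continuous_conj.comp_continuousOn hh.continuousOn_sphere)
  have i1 := circleIntegrable_szego_mul hc hz (w := 0) (by simp)
  have i0 := circleIntegrable_szego_mul hc (z := 0) (w := 0) (by simp) (by simp)
  simp only [map_zero, zero_mul, mul_zero, sub_zero, inv_one, mul_one, one_mul] at h1 h0 i1 i0
  have := Real.circleAverage_fun_sub (i1.const_fun_smul (a := (2 : ℂ))) i0
  rw [Real.circleAverage_fun_smul, h1, h0] at this
  rw [Real.circleAverage_congr_sphere (f₂ := fun ζ =>
    (2 : ℂ) • ((1 - z * conj ζ)⁻¹ * (g ζ + conj (h ζ))) - (g ζ + conj (h ζ))), this]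
  · simp; ring
  intro ζ hζ
  have hζ' : ‖ζ‖ = 1 := by simpa using hζ
  have hcj : conj ζ = ζ⁻¹ := (Complex.inv_eq_conj hζ').symm
  have hn0 : ζ ≠ 0 := by rintro rfl; simp at hζ'
  have hne : ζ - z ≠ 0 := by
    intro h; rw [sub_eq_zero.1 h] at hζ'; exact hz.ne hζ'
  have : (1 - z * conj ζ)⁻¹ = ζ / (ζ - z) := by
    rw [hcj, inv_eq_iff_eq_inv, inv_div]; field_simp
  simp only [this, smul_eq_mul]
  field_simp
  ring

/-! ### Positivity of the kernel by dilation -/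

variable {B : Type*} [NormedAddCommGroup B] [NormedSpace ℂ B]

theorem kernel_apply (φ : ℂ → Op B) (z w : ℂ) (b c : B) :
    kernel φ z w b c = (2 * (1 - z * conj w))⁻¹ * (φ z b c + conj (φ w c b)) := by
  simp [kernel, adjB_apply, mul_add]

theorem norm_real_mul_lt_one {r : ℝ} (hr0 : 0 ≤ r) (hr : r < 1) {z : ℂ} (hz : ‖z‖ ≤ 1) :
    ‖(r : ℂ) * z‖ < 1 := by
  rw [norm_mul, Complex.norm_real, Real.norm_of_nonneg hr0]
  nlinarith [norm_nonneg z]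

theorem diffContOnCl_dilation_apply {φ : ℂ → Op B}
    (hφ : AnalyticOnNhd ℂ φ (Metric.ball 0 1)) {r : ℝ} (hr0 : 0 ≤ r) (hr : r < 1) (x y : B) :
    DiffContOnCl ℂ (fun ζ => φ (r * ζ) x y) (Metric.ball 0 1) := by
  refine DifferentiableOn.diffContOnCl ?_
  rw [closure_ball _ one_ne_zero]
  intro ζ hζ
  have h1 : DifferentiableAt ℂ φ (r * ζ) :=
    (hφ _ (by simpa using norm_real_mul_lt_one hr0 hr (by simpa using hζ))).differentiableAt
  have hE : DifferentiableAt ℂ (evalCLM x y) (φ (r * ζ)) := by fun_prop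
  have h2 : DifferentiableAt ℂ (fun ζ => evalCLM x y (φ ζ)) (r * ζ) :=
    DifferentiableAt.comp (𝕜 := ℂ) (E := ℂ) (F := Op B) (G := ℂ) (r * ζ) hE h1
  exact (DifferentiableAt.comp (𝕜 := ℂ) (E := ℂ) (F := ℂ) (G := ℂ)
    (g := fun ζ => evalCLM x y (φ ζ)) (f := fun ζ : ℂ => (r : ℂ) * ζ) ζ h2
    (differentiableAt_id.const_mul (r : ℂ))).differentiableWithinAt

theorem tendsto_dilation_apply {φ : ℂ → Op B} (hφ : AnalyticOnNhd ℂ φ (Metric.ball 0 1)) {z : ℂ}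
    (hz : ‖z‖ < 1) (x y : B) :
    Filter.Tendsto (fun r : ℝ => φ (r * z) x y) (𝓝[<] 1) (𝓝 (φ z x y)) := by
  have h1 : Filter.Tendsto (fun r : ℝ => (r : ℂ) * z) (𝓝[<] 1) (𝓝 z) :=
    ((by fun_prop : Continuous fun r : ℝ => (r : ℂ) * z).tendsto' 1 z (by simp)).mono_left
      nhdsWithin_le_nhds
  have h2 : Filter.Tendsto φ (𝓝 z) (𝓝 (φ z)) := (hφ z (by simpa using hz)).continuousAt
  exact ((evalCLM x y).continuous.tendsto (φ z)).comp (h2.comp h1)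

theorem kernel_dilation_eq_circleAverage {φ : ℂ → Op B}
    (hφ : AnalyticOnNhd ℂ φ (Metric.ball 0 1)) {r : ℝ} (hr0 : 0 ≤ r) (hr : r < 1) (x y : B)
    {z w : ℂ} (hz : ‖z‖ < 1) (hw : ‖w‖ < 1) :
    kernel (fun ζ => φ (r * ζ)) z w x y = circleAverage (fun ζ => (1 - z * conj ζ)⁻¹ *
      (1 - conj w * ζ)⁻¹ * (2⁻¹ * (φ (r * ζ) x y + conj (φ (r * ζ) y x)))) 0 1 := by
  have := circleAverage_szego_mul_add_conj (diffContOnCl_dilation_apply hφ hr0 hr x y)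
    (diffContOnCl_dilation_apply hφ hr0 hr y x) hz hw
  simp_rw [mul_left_comm _ (2⁻¹ : ℂ), ← smul_eq_mul (2⁻¹ : ℂ)]
  rw [Real.circleAverage_fun_smul, this, kernel_apply]
  rw [mul_inv, smul_eq_mul, mul_assoc]

/-- For a dilation the double sum is the average over the circle of a nonnegative function; letting
r → 1 keeps the sign. -/
theorem IsAnalyticPosRealPart.posKernel {φ : ℂ → Op B} (hφ : IsAnalyticPosRealPart φ) :
    IsPositiveKernelOn (kernel φ) (Metric.ball 0 1) := by
  intro n z b hz
  have hz' : ∀ i, ‖z i‖ < 1 := fun i => by simpa using hz i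
  have hpos : ∀ r : ℝ, 0 ≤ r → r < 1 →
      0 ≤ ∑ i, ∑ j, kernel (fun ζ => φ (r * ζ)) (z i) (z j) (b j) (b i) := by
    intro r hr0 hr
    have hint : ∀ i j, CircleIntegrable (fun ζ => (1 - z i * conj ζ)⁻¹ *
      (1 - conj (z j) * ζ)⁻¹ * (2⁻¹ * (φ (r * ζ) (b j) (b i) + conj (φ (r * ζ) (b i) (b j))))) 0 1 :=
      fun i j => circleIntegrable_szego_mul (continuousOn_const.mul
        ((diffContOnCl_dilation_apply hφ.analytic hr0 hr _ _).continuousOn_sphere.add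
        (Complex.continuous_conj.comp_continuousOn
          (diffContOnCl_dilation_apply hφ.analytic hr0 hr _ _).continuousOn_sphere)))
        (hz' i) (hz' j)
    simp_rw [fun i j => kernel_dilation_eq_circleAverage hφ.analytic hr0 hr (b j) (b i)
      (hz' i) (hz' j)]
    simp_rw [← fun i => Real.circleAverage_fun_sum (fun j (_ : j ∈ Finset.univ) => hint i j)]
    rw [← Real.circleAverage_fun_sum
      (fun i _ => CircleIntegrable.fun_sum Finset.univ fun j _ => hint i j)]
    refine circleAverage_nonneg fun ζ hζ => ?_
    -- The two Szegő factors are absorbed into the vectors: the integrand is half the real-part form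
    -- at Σ (1 − z̄_j ζ)⁻¹ b_j.
    have h := hφ.posReal (r * ζ) (by
      simpa using norm_real_mul_lt_one hr0 hr (by simpa using hζ.le))
      (∑ j, (1 - conj (z j) * ζ)⁻¹ • b j)
    have h2 : (0 : ℂ) ≤ 2⁻¹ := by
      rw [← Complex.ofReal_ofNat, ← Complex.ofReal_inv]; exact Complex.zero_le_real.2 (by norm_num)
    refine (mul_nonneg h2 h).trans_eq ?_
    simp only [map_sum, sum_apply, map_smul, map_smulₛₗ, smul_apply,
      add_apply, adjB_apply, smul_eq_mul, Finset.mul_sum]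
    refine Finset.sum_congr rfl fun i _ => Finset.sum_congr rfl fun j _ => ?_
    simp only [map_inv₀, map_sub, map_one, map_mul, Complex.conj_conj]
    ring
  have hlim : Filter.Tendsto (fun r : ℝ => ∑ i, ∑ j,
      kernel (fun ζ => φ (r * ζ)) (z i) (z j) (b j) (b i)) (𝓝[<] 1)
      (𝓝 (∑ i, ∑ j, kernel φ (z i) (z j) (b j) (b i))) := by
    refine tendsto_finsetSum _ fun i _ => tendsto_finsetSum _ fun j _ => ?_
    simp_rw [kernel_apply]
    exact ((tendsto_dilation_apply hφ.analytic (hz' i) _ _).add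
      (Complex.continuous_conj.continuousAt.tendsto.comp
        (tendsto_dilation_apply hφ.analytic (hz' j) _ _))).const_mul _
  refine ge_of_tendsto hlim ?_
  filter_upwards [Ioo_mem_nhdsLT (zero_lt_one (α := ℝ))] with r hr
  exact hpos r hr.1.le hr.2

end CircleAverage

/-! ### Kolmogorov decomposition and extension to the disk -/

section Extension

/-- Kolmogorov decomposition of a scalar positive kernel. -/
theorem exists_kolmogorov {X : Type u} (s : X → X → ℂ) (hs : ∀ x y, conj (s x y) = s y x)
    (hpos : ∀ f : X →₀ ℂ, 0 ≤ (f.sum fun x a => f.sum fun y b => conj a * b * s x y).re) :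
    ∃ (H : Type u) (_ : NormedAddCommGroup H) (_ : InnerProductSpace ℂ H) (_ : CompleteSpace H)
      (v : X → H), ∀ x y, ⟪v x, v y⟫_ℂ = s x y := by
  let K : Matrix X X (ℂ →L[ℂ] ℂ) := .of fun x y => s x y • 1
  have hK : K.PosSemidef := by
    have htfae := (RKHS.posSemidef_tfae (K := K)).out 0 2
    refine htfae.2 ⟨?_, fun f => ?_⟩
    · ext1 x y
      simp [K, Matrix.conjTranspose_apply, hs]
    · convert hpos f using 1
      simp only [K, Finsupp.sum, map_sum, Complex.re_sum]
      refine Finset.sum_congr rfl fun x _ => Finset.sum_congr rfl fun y _ => ?_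
      simp [← hs x y]
      ring
  have : Fact K.PosSemidef := ⟨hK⟩
  refine ⟨RKHS.OfKernel K, inferInstance, inferInstance, inferInstance,
    fun x => RKHS.kerFun (RKHS.OfKernel K) x (1 : ℂ), fun x y => ?_⟩
  rw [← RKHS.kernel_inner, RKHS.OfKernel.kernel_ofKernel]
  simp [K, hs]

/-- If two families of vectors satisfy `‖S f‖ ≤ ‖T f‖` then a contraction maps one to the other. -/
theorem exists_contraction {E H : Type*} [AddCommGroup E] [Module ℂ E] [NormedAddCommGroup H]
    [InnerProductSpace ℂ H] [CompleteSpace H] (S T : E →ₗ[ℂ] H) (h : ∀ f, ‖S f‖ ≤ ‖T f‖) :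
    ∃ V : H →L[ℂ] H, ‖V‖ ≤ 1 ∧ ∀ f, V (T f) = S f := by
  -- The map T f ↦ S f extends by continuity to the closure `L` of the range, and by zero to its
  -- orthogonal complement.
  let L : Submodule ℂ H := (LinearMap.range T).topologicalClosure
  have hmem : ∀ f, T f ∈ L := fun f => Submodule.le_topologicalClosure _ ⟨f, rfl⟩
  let e : E →ₗ[ℂ] L := T.codRestrict L hmem
  have hcompl : CompleteSpace L := (Submodule.isClosed_topologicalClosure _).completeSpace_coe
  have hd : DenseRange e := by
    intro x
    rw [closure_subtype]
    have : ((↑) '' Set.range e : Set H) = LinearMap.range T := by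
      ext y; simp [e]
    rw [this]
    exact x.2
  have hn : ∀ f, ‖S f‖ ≤ 1 * ‖e f‖ := fun f => by simpa [e] using h f
  refine ⟨(S.extendOfNorm e).comp L.orthogonalProjectionOnto,
    (ContinuousLinearMap.opNorm_comp_le _ _).trans (mul_le_one₀
      (LinearMap.opNorm_extendOfNorm_le hd zero_le_one hn) (norm_nonneg _)
      L.orthogonalProjectionOnto_norm_le), fun f => ?_⟩
  have : L.orthogonalProjectionOnto (T f) = e f :=
    L.orthogonalProjectionOnto_mem_subspace_eq_self ⟨T f, hmem f⟩
  rw [ContinuousLinearMap.comp_apply, this, LinearMap.extendOfNorm_eq hd ⟨1, hn⟩]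

variable {B : Type u} [NormedAddCommGroup B] [NormedSpace ℂ B]

theorem conj_kernel_apply (φ : ℂ → Op B) (z w : ℂ) (b c : B) :
    conj (kernel φ z w b c) = kernel φ w z c b := by
  simp only [kernel_apply, map_mul, map_inv₀, map_sub, map_add, map_one, Complex.conj_conj,
    map_ofNat]
  ring

theorem IsPositiveKernelOn.sum_nonneg {K : ℂ → ℂ → Op B} {Ω : Set ℂ}
    (hK : IsPositiveKernelOn K Ω) {ι : Type*} (s : Finset ι) (z : ι → ℂ) (b : ι → B)
    (hz : ∀ i, z i ∈ Ω) : 0 ≤ ∑ i ∈ s, ∑ j ∈ s, K (z i) (z j) (b j) (b i) := by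
  have := hK s.card (fun k => z (s.equivFin.symm k)) (fun k => b (s.equivFin.symm k))
    fun k => hz _
  rw [← Finset.sum_coe_sort s]
  simp_rw [← Finset.sum_coe_sort s (fun j => K _ (z j) (b j) _)]
  rw [← s.equivFin.symm.sum_comp]
  simp_rw [← s.equivFin.symm.sum_comp (fun j : s => K _ (z j) (b j) _)]
  exact this

/-- Kolmogorov decomposition of a positive `L(B, B*)`-valued kernel of Carathéodory type. -/
theorem exists_kernel_decomposition {φ : ℂ → Op B} {Ω : Set ℂ}
    (hφ : IsPositiveKernelOn (kernel φ) Ω) :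
    ∃ (H : Type u) (_ : NormedAddCommGroup H) (_ : InnerProductSpace ℂ H) (_ : CompleteSpace H)
      (v : Ω → B → H), ∀ z w b c, ⟪v z c, v w b⟫_ℂ = kernel φ z w b c := by
  obtain ⟨H, i1, i2, i3, v, hv⟩ := exists_kolmogorov
    -- Base point and vector are merged into one index; `q.2` sits in the linear slot, matching the
    -- second slot of the inner product.
    (fun p q : Ω × B => kernel φ p.1 q.1 q.2 p.2) (fun p q => conj_kernel_apply _ _ _ _ _)
    (fun f => by
      have := hφ.sum_nonneg f.support (fun p => (p.1 : ℂ)) (fun p => f p • p.2) fun p => p.1.2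
      refine (Complex.nonneg_iff.1 this).1.trans_eq (congrArg _ ?_)
      refine Finset.sum_congr rfl fun p _ => Finset.sum_congr rfl fun q _ => ?_
      simp
      ring)
  exact ⟨H, i1, i2, i3, fun z b => v (z, b), fun z w b c => hv _ _⟩

/-! ### Transfer functions of contractions -/

section Transfer

variable {H : Type*} [NormedAddCommGroup H] [InnerProductSpace ℂ H]

/-- The transfer function `-A* + 2 C* (1 - z W)⁻¹ C`. -/
noncomputable def transfer (A : Op B) (C : B →L[ℂ] H) (W : H →L[ℂ] H) (z : ℂ) : Op B :=
  -adjB A + (2 : ℂ) • (((adj C).comp (innerSLFlip ℂ)).comp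
    ((Ring.inverse (1 - z • W)).comp C))

theorem transfer_apply (A : Op B) (C : B →L[ℂ] H) (W : H →L[ℂ] H) (z : ℂ) (b c : B) :
    transfer A C W z b c = -conj (A c b) + 2 * ⟪C c, Ring.inverse (1 - z • W) (C b)⟫_ℂ := by
  simp [transfer, adjB_apply, adj_apply]

variable [CompleteSpace H]

theorem norm_smul_lt_one {W : H →L[ℂ] H} (hW : ‖W‖ ≤ 1) {z : ℂ} (hz : ‖z‖ < 1) : ‖z • W‖ < 1 := by
  rw [norm_smul]
  nlinarith [norm_nonneg z, norm_nonneg W]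

theorem sub_smul_inverse_one_sub_apply {W : H →L[ℂ] H} (hW : ‖W‖ ≤ 1) {z : ℂ} (hz : ‖z‖ < 1)
    (h : H) :
    Ring.inverse (1 - z • W) h - z • W (Ring.inverse (1 - z • W) h) = h := by
  have := Ring.mul_inverse_cancel _ (isUnit_one_sub_of_norm_lt_one (norm_smul_lt_one hW hz))
  simpa using congrArg (fun T : H →L[ℂ] H => T h) this

theorem analyticOnNhd_transfer (A : Op B) (C : B →L[ℂ] H) {W : H →L[ℂ] H} (hW : ‖W‖ ≤ 1) :
    AnalyticOnNhd ℂ (transfer A C W) (Metric.ball 0 1) := by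
  refine DifferentiableOn.analyticOnNhd (fun z hz => ?_) Metric.isOpen_ball
  have hu := isUnit_one_sub_of_norm_lt_one (norm_smul_lt_one hW (by simpa using hz))
  have h1 : DifferentiableAt ℂ (fun z : ℂ => 1 - z • W) z := by fun_prop
  have h2 : DifferentiableAt ℂ (fun z : ℂ => Ring.inverse (1 - z • W)) z := by
    exact DifferentiableAt.comp (f := fun z : ℂ => 1 - z • W) z
      (differentiableAt_inverse hu) h1
  refine DifferentiableAt.differentiableWithinAt ?_
  exact (((differentiableAt_const ((adj C).comp (innerSLFlip ℂ))).clm_comp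
    (h2.clm_comp (differentiableAt_const C))).const_smul (2 : ℂ)).const_add (-adjB A)

/-- With u = (1 − zW)⁻¹ C b, substituting C b = u − zWu turns the real part of the form into ‖u‖² −
‖zWu‖², nonnegative because zW is a contraction. -/
theorem isAnalyticPosRealPart_transfer {A : Op B} {C : B →L[ℂ] H} {W : H →L[ℂ] H} (hW : ‖W‖ ≤ 1)
    (hA : ∀ b, (A b b).re = ‖C b‖ ^ 2) : IsAnalyticPosRealPart (transfer A C W) := by
  refine ⟨analyticOnNhd_transfer A C hW, fun z hz b => ?_⟩
  have hz : ‖z‖ < 1 := by simpa using hz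
  set u := Ring.inverse (1 - z • W) (C b) with hu
  have hC : C b = u - z • W u := (sub_smul_inverse_one_sub_apply hW hz _).symm
  have key : (transfer A C W z b b).re = ‖u‖ ^ 2 - ‖z • W u‖ ^ 2 := by
    have h1 := hA b
    rw [transfer_apply, ← hu]
    have h2 : (⟪C b, u⟫_ℂ).re = ‖u‖ ^ 2 - (⟪z • W u, u⟫_ℂ).re := by
      rw [hC, inner_sub_left, Complex.sub_re, inner_self_eq_norm_sq_to_K]
      norm_cast
    have h3 : ‖C b‖ ^ 2 = ‖u‖ ^ 2 - 2 * (⟪z • W u, u⟫_ℂ).re + ‖z • W u‖ ^ 2 := by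
      rw [hC, norm_sub_sq (𝕜 := ℂ), inner_re_symm]
      rfl
    simp [h1, h2, h3]
    ring
  have hle : ‖z • W u‖ ≤ ‖u‖ := by
    have := (z • W).le_opNorm u
    exact this.trans (mul_le_of_le_one_left (norm_nonneg _) (norm_smul_lt_one hW hz).le)
  rw [add_apply, add_apply, adjB_apply, Complex.add_conj, key]
  have : ‖z • W u‖ ^ 2 ≤ ‖u‖ ^ 2 := by gcongr
  exact Complex.zero_le_real.2 (by linarith)

end Transfer

/-- A function with positive kernel on a set containing the origin is the restriction of an
analytic function with positive real part on the disk. -/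
theorem IsPositiveKernelOn.exists_extension {φ : ℂ → Op B} {Ω : Set ℂ} (h0 : (0 : ℂ) ∈ Ω)
    (hΩ : Ω ⊆ Metric.ball 0 1) (hφ : IsPositiveKernelOn (kernel φ) Ω) :
    ∃ Φ : ℂ → Op B, IsAnalyticPosRealPart Φ ∧ Set.EqOn φ Φ Ω := by
  obtain ⟨H, i1, i2, i3, v, hv⟩ := exists_kernel_decomposition hφ
  let o : Ω := ⟨0, h0⟩
  have hlt : ∀ z ∈ Ω, ‖z‖ < 1 := fun z hz => by simpa using hΩ hz
  have hsq : ∀ b, ‖v o b‖ ^ 2 = (φ 0 b b).re := fun b => by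
    have := hv o o b b
    rw [inner_self_eq_norm_sq_to_K, kernel_apply, Complex.add_conj] at this
    have h2 := congrArg Complex.re this
    simp [o] at h2
    norm_cast at h2
  -- The decomposition gives only a map of sets; linearity holds because the squared norm of each
  -- defect, expanded by `hv`, vanishes.
  let C : B →L[ℂ] H := LinearMap.mkContinuous
    { toFun := v o
      map_add' := fun b c => by
        refine sub_eq_zero.1 ((inner_self_eq_zero (𝕜 := ℂ)).1 ?_)
        simp only [inner_sub_left, inner_sub_right, inner_add_left, inner_add_right, hv, map_add,
          add_apply]
        ring
      map_smul' := fun a b => by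
        refine sub_eq_zero.1 ((inner_self_eq_zero (𝕜 := ℂ)).1 ?_)
        simp only [inner_sub_left, inner_sub_right, inner_smul_left, inner_smul_right, hv,
          map_smul, map_smulₛₗ, smul_apply, smul_eq_mul, RingHom.id_apply]
        ring } (√‖φ 0‖) (fun b => by
        refine le_of_sq_le_sq ?_ (by positivity)
        change ‖v o b‖ ^ 2 ≤ _
        rw [hsq, mul_pow, Real.sq_sqrt (norm_nonneg (φ 0)), sq, ← mul_assoc]
        exact (Complex.re_le_norm _).trans ((φ 0).le_opNorm₂ b b))
  have hC : ∀ b, C b = v o b := fun b => rfl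
  let T : (Ω × B →₀ ℂ) →ₗ[ℂ] H := Finsupp.linearCombination ℂ fun p => conj (p.1 : ℂ) • v p.1 p.2
  let S : (Ω × B →₀ ℂ) →ₗ[ℂ] H := Finsupp.linearCombination ℂ fun p => v p.1 p.2 - v o p.2
  have hST : ∀ f, ‖S f‖ ≤ ‖T f‖ := fun f => by
    -- Termwise this is K(z,w) − K(z,0) − K(0,w) + K(0,0) = z w̄ K(z,w), after clearing the
    -- denominator 1 − z w̄.
    have : ⟪S f, S f⟫_ℂ = ⟪T f, T f⟫_ℂ := by
      simp only [S, T, Finsupp.linearCombination_apply, Finsupp.sum, sum_inner, inner_sum]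
      refine Finset.sum_congr rfl fun p _ => Finset.sum_congr rfl fun q _ => ?_
      have hne := one_sub_mul_conj_ne_zero (hlt _ q.1.2) (hlt _ p.1.2).le
      simp only [inner_smul_left, inner_smul_right, inner_sub_left, inner_sub_right, hv,
        kernel_apply, o, Complex.conj_conj, map_zero, zero_mul, mul_zero, sub_zero]
      field_simp
      ring
    rw [inner_self_eq_norm_sq_to_K, inner_self_eq_norm_sq_to_K] at this
    norm_cast at this
    exact ((sq_eq_sq₀ (norm_nonneg _) (norm_nonneg _)).1 this).le
  obtain ⟨V, hV, hVT⟩ := exists_contraction S T hST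
  have hVv : ∀ (z : Ω) b, conj (z : ℂ) • V (v z b) = v z b - v o b := fun z b => by
    simpa [S, T] using hVT (Finsupp.single (z, b) 1)
  have hW : ‖V.adjoint‖ ≤ 1 := by simpa using hV
  refine ⟨transfer (φ 0) C V.adjoint, isAnalyticPosRealPart_transfer hW
    fun b => (hsq b).symm, fun z hz => ?_⟩
  ext b c
  rw [transfer_apply]
  set u := Ring.inverse (1 - z • V.adjoint) (C b) with hu
  have hCb := sub_smul_inverse_one_sub_apply hW (hlt z hz) (C b)
  rw [← hu] at hCb
  -- Here v_z = (1 − z̄V)⁻¹ v_0 is used in adjoint form. The left side is K(z,0), and 2K(z,0) −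
  -- φ(0)* = φ(z).
  have h1 : ⟪v ⟨z, hz⟩ c, C b⟫_ℂ = ⟪C c, u⟫_ℂ := by
    rw [← hCb, inner_sub_right, inner_smul_right, ContinuousLinearMap.adjoint_inner_right,
      ← inner_conj_symm, hC]
    have := congrArg (fun x => ⟪x, u⟫_ℂ) (hVv ⟨z, hz⟩ c)
    simp only [inner_smul_left, inner_sub_left, Complex.conj_conj] at this
    rw [inner_conj_symm]
    linear_combination -this
  rw [← h1, hC, hv, kernel_apply]
  simp [o]

end Extension

/-! ### Herglotz representation -/

section Representation

variable {B : Type u} [NormedAddCommGroup B] [NormedSpace ℂ B]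

/-- The nodes of a subdivision of `[a, b]` lie in `[a, b]`. -/
theorem subdivision_mem_Icc {a b : ℝ} {m : ℕ} {t : ℕ → ℝ} (h0 : t 0 = a) (hm : t m = b)
    (ht : ∀ j < m, t j ≤ t (j + 1)) : ∀ j ≤ m, t j ∈ Set.Icc a b := by
  have hmono : ∀ i j, i ≤ j → j ≤ m → t i ≤ t j := fun i j hij => by
    induction j, hij using Nat.le_induction with
    | base => exact fun _ => le_rfl
    | succ k _ ih => exact fun hk => (ih (by omega)).trans (ht k hk)
  exact fun j hj => ⟨h0 ▸ hmono 0 j j.zero_le hj, hm ▸ hmono j m hj le_rfl⟩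

/-- Riemann–Stieltjes sums against an indefinite integral of positive operators. -/
theorem norm_stieltjesSum_sub_integral_le {Q : ℝ → Op B} (hQc : ∀ x y, Continuous fun s => Q s x y)
    (hQ : ∀ s, IsPositiveOp (Q s)) {M : ℝ → Op B} {a b : ℝ}
    (hM : ∀ t x y, M t x y = ∫ s in a..t, Q s x y) {f : ℝ → ℂ} (hf : Continuous f) {η δ : ℝ}
    (hη : ∀ s ∈ Set.Icc a b, ∀ s' ∈ Set.Icc a b, |s - s'| ≤ δ → ‖f s - f s'‖ ≤ η) (x y : B)
    {m : ℕ} {t ξ : ℕ → ℝ} (h0 : t 0 = a) (hm : t m = b)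
    (ht : ∀ j < m, t j ≤ ξ j ∧ ξ j ≤ t (j + 1) ∧ t (j + 1) - t j ≤ δ) :
    2 * ‖(∑ j ∈ Finset.range m, f (ξ j) * (M (t (j + 1)) - M (t j)) x y) -
      ∫ s in a..b, f s * Q s x y‖ ≤ η * ((M b x x).re + (M b y y).re) := by
  have hmem := subdivision_mem_Icc h0 hm fun j hj => (ht j hj).1.trans (ht j hj).2.1
  have hint : ∀ x y u v, IntervalIntegrable (fun s => Q s x y) MeasureTheory.volume u v :=
    fun x y u v => (hQc x y).intervalIntegrable u v
  have hfint : ∀ u v, IntervalIntegrable (fun s => f s * Q s x y) MeasureTheory.volume u v :=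
    fun u v => (hf.mul (hQc x y)).intervalIntegrable u v
  have hsub : ∀ x y u v, (M v - M u) x y = ∫ s in u..v, Q s x y := fun x y u v => by
    rw [sub_apply, sub_apply, hM, hM,
      intervalIntegral.integral_interval_sub_left (hint ..) (hint ..)]
  have hre : ∀ x u v, ((M v - M u) x x).re = ∫ s in u..v, (Q s x x).re := fun x u v => by
    rw [hsub]
    exact (Complex.reCLM.intervalIntegral_comp_comm (hint x x u v)).symm
  have hM0 : M a = 0 := by ext x y; simp [hM]
  -- On one subinterval f varies by at most η, and 2|⟨Qx,y⟩| ≤ ⟨Qx,x⟩ + ⟨Qy,y⟩ bounds the error by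
  -- diagonal increments of `M`, which telescope over the subdivision.
  have hterm : ∀ j ∈ Finset.range m, 2 * ‖f (ξ j) * (M (t (j + 1)) - M (t j)) x y -
      ∫ s in t j..t (j + 1), f s * Q s x y‖ ≤
      η * (((M (t (j + 1)) - M (t j)) x x).re + ((M (t (j + 1)) - M (t j)) y y).re) := by
    intro j hj
    rw [Finset.mem_range] at hj
    obtain ⟨h1, h2, h3⟩ := ht j hj
    have hle := h1.trans h2
    rw [hsub, ← intervalIntegral.integral_const_mul, ← intervalIntegral.integral_sub
      ((hint x y _ _).const_mul _) (hfint _ _), hre, hre, ← intervalIntegral.integral_add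
      (by exact (Complex.continuous_re.comp (hQc x x)).intervalIntegrable _ _)
      (by exact (Complex.continuous_re.comp (hQc y y)).intervalIntegrable _ _),
      ← intervalIntegral.integral_const_mul]
    have hi : IntervalIntegrable (fun s => η * ((Q s x x).re + (Q s y y).re))
        MeasureTheory.volume (t j) (t (j + 1)) :=
      (continuous_const.mul ((Complex.continuous_re.comp (hQc x x)).add
        (Complex.continuous_re.comp (hQc y y)))).intervalIntegrable _ _
    have := intervalIntegral.norm_integral_le_of_norm_le hle
      (f := fun s => f (ξ j) * Q s x y - f s * Q s x y)
      (g := fun s => 2⁻¹ * (η * ((Q s x x).re + (Q s y y).re)))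
      (μ := MeasureTheory.volume) (Filter.Eventually.of_forall fun s hs => by
        have h4 : ‖f (ξ j) - f s‖ ≤ η := by
          have := hmem j hj.le
          have := hmem (j + 1) hj
          refine hη _ ⟨?_, ?_⟩ _ ⟨?_, ?_⟩ (abs_le.2 ⟨?_, ?_⟩) <;>
            simp only [Set.mem_Icc, Set.mem_Ioc] at * <;> linarith
        rw [← sub_mul, norm_mul]
        have h5 := (hQ s).two_mul_norm_apply_le x y
        calc ‖f (ξ j) - f s‖ * ‖Q s x y‖ ≤ η * ‖Q s x y‖ := by gcongr
          _ = 2⁻¹ * (η * (2 * ‖Q s x y‖)) := by ring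
          _ ≤ _ := by
            have := (norm_nonneg _).trans h4
            gcongr) (hi.const_mul _)
    rw [intervalIntegral.integral_const_mul] at this
    linarith
  have htel : ∀ x, (M b x x).re = ∑ j ∈ Finset.range m, ((M (t (j + 1)) - M (t j)) x x).re := by
    intro x
    simp only [sub_apply, Complex.sub_re]
    rw [Finset.sum_range_sub (fun j => (M (t j) x x).re), hm, h0, hM0]
    simp
  have hsum : ∫ s in a..b, f s * Q s x y =
      ∑ j ∈ Finset.range m, ∫ s in t j..t (j + 1), f s * Q s x y := by
    rw [intervalIntegral.sum_integral_adjacent_intervals fun j _ => hfint _ _, h0, hm]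
  rw [hsum, ← Finset.sum_sub_distrib, htel, htel, ← Finset.sum_add_distrib, Finset.mul_sum]
  refine (mul_le_mul_of_nonneg_left (norm_sum_le _ _) zero_le_two).trans ?_
  rw [Finset.mul_sum]
  exact Finset.sum_le_sum hterm

/-- The density `(4π)⁻¹ (φ(r e^{is}) + φ(r e^{is})*|_B)`. -/
noncomputable def boundaryDensity (φ : ℂ → Op B) (r s : ℝ) : Op B :=
  ((4 * Real.pi)⁻¹ : ℝ) • (φ (r * circleMap 0 1 s) + adjB (φ (r * circleMap 0 1 s)))

/-- The indefinite integral of `boundaryDensity`. -/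
noncomputable def boundaryIntegral (φ : ℂ → Op B) (r t : ℝ) : Op B :=
  ((4 * Real.pi)⁻¹ : ℝ) • ((∫ s in (0 : ℝ)..t, φ (r * circleMap 0 1 s)) +
    adjB (∫ s in (0 : ℝ)..t, φ (r * circleMap 0 1 s)))

theorem boundaryDensity_apply (φ : ℂ → Op B) (r s : ℝ) (x y : B) :
    boundaryDensity φ r s x y = ((4 * Real.pi)⁻¹ : ℝ) *
      (φ (r * circleMap 0 1 s) x y + conj (φ (r * circleMap 0 1 s) y x)) := by
  simp [boundaryDensity, adjB_apply, mul_add]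

section Analytic

variable {φ : ℂ → Op B} {r : ℝ}

theorem norm_mul_circleMap_lt_one (hr0 : 0 ≤ r) (hr : r < 1) (s : ℝ) :
    ‖(r : ℂ) * circleMap 0 1 s‖ < 1 := norm_real_mul_lt_one hr0 hr (by simp)

theorem continuous_dilation_circleMap (hφ : AnalyticOnNhd ℂ φ (Metric.ball 0 1)) (hr0 : 0 ≤ r)
    (hr : r < 1) : Continuous fun s : ℝ => φ (r * circleMap 0 1 s) :=
  hφ.continuousOn.comp_continuous (continuous_const.mul (continuous_circleMap 0 1))
    fun s => by simpa using norm_mul_circleMap_lt_one hr0 hr s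

theorem continuous_dilation_circleMap_apply (hφ : AnalyticOnNhd ℂ φ (Metric.ball 0 1))
    (hr0 : 0 ≤ r) (hr : r < 1) (x y : B) : Continuous fun s : ℝ => φ (r * circleMap 0 1 s) x y :=
  (evalCLM x y).continuous.comp (continuous_dilation_circleMap hφ hr0 hr)

theorem continuous_boundaryDensity_apply (hφ : AnalyticOnNhd ℂ φ (Metric.ball 0 1)) (hr0 : 0 ≤ r)
    (hr : r < 1) (x y : B) : Continuous fun s => boundaryDensity φ r s x y := by
  simp_rw [boundaryDensity_apply]
  exact continuous_const.mul ((continuous_dilation_circleMap_apply hφ hr0 hr x y).add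
    (Complex.continuous_conj.comp (continuous_dilation_circleMap_apply hφ hr0 hr y x)))

theorem isPositiveOp_boundaryDensity (hφ : IsAnalyticPosRealPart φ) (hr0 : 0 ≤ r)
    (hr : r < 1) (s : ℝ) : IsPositiveOp (boundaryDensity φ r s) := fun b => by
  have := hφ.posReal (r * circleMap 0 1 s) (by simpa using norm_mul_circleMap_lt_one hr0 hr s) b
  rw [boundaryDensity_apply]
  exact mul_nonneg (Complex.zero_le_real.2 (by positivity)) this

theorem boundaryIntegral_apply (hφ : AnalyticOnNhd ℂ φ (Metric.ball 0 1)) (hr0 : 0 ≤ r)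
    (hr : r < 1) (t : ℝ) (x y : B) :
    boundaryIntegral φ r t x y = ∫ s in (0 : ℝ)..t, boundaryDensity φ r s x y := by
  have hc := continuous_dilation_circleMap hφ hr0 hr
  have h : ∀ x y, (∫ s in (0 : ℝ)..t, φ (r * circleMap 0 1 s)) x y =
      ∫ s in (0 : ℝ)..t, φ (r * circleMap 0 1 s) x y := fun x y =>
    (ContinuousLinearMap.intervalIntegral_comp_comm (𝕜 := ℂ) (E := Op B) (F := ℂ) (evalCLM x y)
      (hc.intervalIntegrable 0 t)).symm
  have hconj : conj (∫ s in (0 : ℝ)..t, φ (r * circleMap 0 1 s) y x) =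
      ∫ s in (0 : ℝ)..t, conj (φ (r * circleMap 0 1 s) y x) := by
    simp only [intervalIntegral.intervalIntegral_eq_integral_uIoc, integral_conj,
      Complex.real_smul, map_mul, Complex.conj_ofReal]
  simp_rw [boundaryDensity_apply]
  rw [intervalIntegral.integral_const_mul, intervalIntegral.integral_add
    ((continuous_dilation_circleMap_apply hφ hr0 hr x y).intervalIntegrable _ _)
    (by exact (Complex.continuous_conj.comp
      (continuous_dilation_circleMap_apply hφ hr0 hr y x)).intervalIntegrable _ _),
    ← h, ← hconj, ← h]
  simp [boundaryIntegral, adjB_apply, mul_add]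

theorem isPositiveOp_boundaryIntegral_sub (hφ : IsAnalyticPosRealPart φ) (hr0 : 0 ≤ r)
    (hr : r < 1) {s t : ℝ} (hst : s ≤ t) :
    IsPositiveOp (boundaryIntegral φ r t - boundaryIntegral φ r s) := fun b => by
  have hc := continuous_boundaryDensity_apply hφ.analytic hr0 hr b b
  rw [sub_apply, sub_apply, boundaryIntegral_apply hφ.analytic hr0 hr,
    boundaryIntegral_apply hφ.analytic hr0 hr, intervalIntegral.integral_interval_sub_left
      (hc.intervalIntegrable _ _) (hc.intervalIntegrable _ _)]
  have : ∀ u, boundaryDensity φ r u b b = ((boundaryDensity φ r u b b).re : ℂ) := fun u =>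
    Complex.ext (by simp)
      (by simpa using (Complex.nonneg_iff.1 (isPositiveOp_boundaryDensity hφ hr0 hr u b)).2.symm)
  rw [intervalIntegral.integral_congr fun u _ => this u, intervalIntegral.integral_ofReal]
  exact Complex.zero_le_real.2 (intervalIntegral.integral_nonneg hst fun u _ =>
    (Complex.nonneg_iff.1 (isPositiveOp_boundaryDensity hφ hr0 hr u b)).1)

theorem boundaryIntegral_zero : boundaryIntegral φ r 0 = 0 := by
  ext x y
  simp [boundaryIntegral, adjB_apply]

theorem isPositiveOp_boundaryIntegral (hφ : IsAnalyticPosRealPart φ) (hr0 : 0 ≤ r)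
    (hr : r < 1) {t : ℝ} (ht : 0 ≤ t) : IsPositiveOp (boundaryIntegral φ r t) := fun b => by
  simpa [boundaryIntegral_zero] using isPositiveOp_boundaryIntegral_sub hφ hr0 hr ht b

theorem integral_mul_boundaryDensity (f : ℂ → ℂ) (x y : B) :
    ∫ s in (0 : ℝ)..2 * Real.pi, f (circleMap 0 1 s) * boundaryDensity φ r s x y =
      2⁻¹ * Real.circleAverage (fun ζ => f ζ * (φ (r * ζ) x y + conj (φ (r * ζ) y x))) 0 1 := by
  simp_rw [boundaryDensity_apply, mul_left_comm (f _)]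
  rw [intervalIntegral.integral_const_mul, Real.circleAverage_def, Complex.real_smul, ← mul_assoc]
  congr 1
  push_cast
  rw [← mul_inv]
  congr 1
  ring

/-- The Schwarz formula for the dilation; the correction does not depend on r and becomes the
constant `D` of the representation. -/
theorem integral_herglotz_mul_boundaryDensity (hφ : AnalyticOnNhd ℂ φ (Metric.ball 0 1))
    (hr0 : 0 ≤ r) (hr : r < 1) {z : ℂ} (hz : ‖z‖ < 1) (x y : B) :
    ∫ s in (0 : ℝ)..2 * Real.pi,
      (circleMap 0 1 s + z) / (circleMap 0 1 s - z) * boundaryDensity φ r s x y =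
      φ (r * z) x y - 2⁻¹ * (φ 0 x y - conj (φ 0 y x)) := by
  rw [integral_mul_boundaryDensity (fun ζ => (ζ + z) / (ζ - z)),
    circleAverage_herglotz_mul_add_conj (diffContOnCl_dilation_apply hφ hr0 hr x y)
      (diffContOnCl_dilation_apply hφ hr0 hr y x) hz]
  simp only [mul_zero]
  ring

/-- Mean value property, read off from the Schwarz formula at z = 0. Independence of r makes all
later bounds uniform. -/
theorem boundaryIntegral_two_pi_apply (hφ : AnalyticOnNhd ℂ φ (Metric.ball 0 1))
    (hr0 : 0 ≤ r) (hr : r < 1) (x : B) :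
    (boundaryIntegral φ r (2 * Real.pi) x x).re = (φ 0 x x).re := by
  have h := circleAverage_herglotz_mul_add_conj (diffContOnCl_dilation_apply hφ hr0 hr x x)
    (diffContOnCl_dilation_apply hφ hr0 hr x x) (z := 0) (by simp)
  have := integral_mul_boundaryDensity (φ := φ) (r := r) (fun ζ => (ζ + 0) / (ζ - 0)) x x
  rw [h] at this
  have h1 : ∀ s, (circleMap 0 1 s + 0) / (circleMap 0 1 s - 0) = 1 := fun s => by
    rw [add_zero, sub_zero, div_self (circleMap_ne_center one_ne_zero)]
  simp_rw [h1, one_mul] at this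
  rw [boundaryIntegral_apply hφ hr0 hr, this]
  simp

theorem norm_boundaryIntegral_le (hφ : IsAnalyticPosRealPart φ) (hr0 : 0 ≤ r)
    (hr : r < 1) {t : ℝ} (ht : t ∈ Set.Icc 0 (2 * Real.pi)) : ‖boundaryIntegral φ r t‖ ≤ ‖φ 0‖ := by
  refine (isPositiveOp_boundaryIntegral hφ hr0 hr ht.1).norm_le (norm_nonneg (φ 0)) fun x => ?_
  have h1 := (isPositiveOp_iff_re_im.1 (isPositiveOp_boundaryIntegral_sub hφ hr0 hr ht.2) x).1
  rw [sub_apply, sub_apply, Complex.sub_re, boundaryIntegral_two_pi_apply hφ.analytic hr0 hr] at h1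
  rw [sq, ← mul_assoc]
  exact (sub_nonneg.1 h1).trans ((Complex.re_le_norm _).trans ((φ 0).le_opNorm₂ x x))

end Analytic

theorem continuous_herglotz_kernel {z : ℂ} (hz : ‖z‖ < 1) :
    Continuous fun s : ℝ => (circleMap 0 1 s + z) / (circleMap 0 1 s - z) := by
  refine Continuous.div₀ (by fun_prop) (by fun_prop) fun s h => ?_
  have := congrArg norm (sub_eq_zero.1 h)
  simp at this
  exact hz.ne this.symm

/-- The Herglotz representation. -/
theorem IsAnalyticPosRealPart.exists_herglotz {φ : ℂ → Op B} (hφ : IsAnalyticPosRealPart φ) :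
    ∃ (D : Op B) (M : ℝ → Op B), IsPurelyImaginary D ∧
      IsIncreasingPositiveOn M 0 (2 * Real.pi) ∧
      ∀ z ∈ Metric.ball (0 : ℂ) 1, ∃ J : Op B, HasWeakStieltjesIntegral
        (fun t : ℝ => (Complex.exp (Complex.I * t) + z) / (Complex.exp (Complex.I * t) - z))
        M 0 (2 * Real.pi) J ∧ φ z = D + J := by
  let U : Ultrafilter ℝ := Ultrafilter.of (𝓝[<] 1)
  have hU : (U : Filter ℝ) ≤ 𝓝[<] 1 := Ultrafilter.of_le _
  have hev : ∀ᶠ r : ℝ in U, 0 ≤ r ∧ r < 1 := by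
    refine hU ?_
    filter_upwards [Ioo_mem_nhdsLT (zero_lt_one (α := ℝ))] with r hr
    exact ⟨hr.1.le, hr.2⟩
  have hlim : ∀ t, ∃ A : Op B, t ∈ Set.Icc 0 (2 * Real.pi) → ∀ x y,
      Filter.Tendsto (fun r => boundaryIntegral φ r t x y) U (𝓝 (A x y)) := fun t => by
    by_cases ht : t ∈ Set.Icc 0 (2 * Real.pi)
    · obtain ⟨A, hA⟩ := exists_tendsto_apply_of_norm_le U (fun r => boundaryIntegral φ r t)
        (hev.mono fun r hr => norm_boundaryIntegral_le hφ hr.1 hr.2 ht)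
      exact ⟨A, fun _ => hA⟩
    -- The uniform bound is available only on [0, 2π]; elsewhere `M` is set to 0, a value that never
    -- enters.
    · exact ⟨0, fun h => absurd h ht⟩
  choose M hM using hlim
  let D : Op B := (2⁻¹ : ℂ) • (φ 0 - adjB (φ 0))
  have hDapp : ∀ x y, D x y = 2⁻¹ * (φ 0 x y - conj (φ 0 y x)) := fun x y => by
    simp [D, adjB_apply]
  refine ⟨D, M, ?_, ⟨fun t ht b => ?_, fun s hs t ht hst b => ?_⟩, fun z hz => ⟨φ z - D, ?_, ?_⟩⟩
  · ext x y
    rw [add_apply, add_apply, adjB_apply, hDapp, hDapp]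
    simp only [map_mul, map_inv₀, map_ofNat, map_sub, Complex.conj_conj, zero_apply]
    ring
  · refine ge_of_tendsto (hM t ht b b) (hev.mono fun r hr => ?_)
    exact isPositiveOp_boundaryIntegral hφ hr.1 hr.2 ht.1 b
  · refine ge_of_tendsto ((hM t ht b b).sub (hM s hs b b)) (hev.mono fun r hr => ?_)
    exact isPositiveOp_boundaryIntegral_sub hφ hr.1 hr.2 hst b
  swap
  · abel
  have hz : ‖z‖ < 1 := by simpa using hz
  set f : ℝ → ℂ := fun s => (circleMap 0 1 s + z) / (circleMap 0 1 s - z) with hf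
  have hfe : (fun t : ℝ => (Complex.exp (Complex.I * t) + z) / (Complex.exp (Complex.I * t) - z)) =
      f := by
    ext t; simp [hf, circleMap, mul_comm]
  rw [hfe]
  have hfc : Continuous f := continuous_herglotz_kernel hz
  intro x y ε hε
  set K : ℝ := (φ 0 x x).re + (φ 0 y y).re with hK
  obtain ⟨η, hη, hηK⟩ : ∃ η : ℝ, 0 < η ∧ η * K < 2 * ε := by
    -- The `+ 1` keeps the denominator positive, and η K ≤ ε < 2ε leaves room for strictness.
    refine ⟨ε / (|K| + 1), by positivity, ?_⟩
    have : ε / (|K| + 1) * K ≤ ε := by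
      rw [div_mul_eq_mul_div, div_le_iff₀ (by positivity)]
      nlinarith [le_abs_self K]
    linarith
  obtain ⟨δ, hδ, hfδ⟩ := Metric.uniformContinuousOn_iff_le.1
    (isCompact_Icc.uniformContinuousOn_of_continuous (hfc.continuousOn (s := Set.Icc 0 (2 * Real.pi))))
    η hη
  refine ⟨δ, hδ, fun m t ξ h0 hm ht => ?_⟩
  have hmem := subdivision_mem_Icc h0 hm fun j hj => (ht j hj).1.trans (ht j hj).2.1
  -- For a fixed subdivision the sum is finite, so the estimate for the dilations passes to the
  -- limit; `δ` and the bound η K do not depend on r.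
  have hle : 2 * ‖(∑ j ∈ Finset.range m, f (ξ j) * (M (t (j + 1)) - M (t j)) x y) -
      (φ z - D) x y‖ ≤ η * K := by
    refine le_of_tendsto ((((tendsto_finsetSum _ fun j hj => (((hM (t (j + 1)) (hmem _ (by
      simpa using hj)) x y).sub (hM (t j) (hmem _ (by simpa using (Finset.mem_range.1 hj).le)) x
      y)).const_mul (f (ξ j)))).sub
      (((tendsto_dilation_apply hφ.analytic hz x y).mono_left hU).sub_const (D x y))).norm).const_mul
      2) (hev.mono fun r hr => ?_)
    have := norm_stieltjesSum_sub_integral_le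
      (continuous_boundaryDensity_apply hφ.analytic hr.1 hr.2)
      (isPositiveOp_boundaryDensity hφ hr.1 hr.2)
      (boundaryIntegral_apply hφ.analytic hr.1 hr.2) hfc
      (fun s hs s' hs' h => by simpa [dist_eq_norm] using hfδ s hs s' hs' h) x y h0 hm ht
    rwa [integral_herglotz_mul_boundaryDensity hφ.analytic hr.1 hr.2 hz, ← hDapp,
      boundaryIntegral_two_pi_apply hφ.analytic hr.1 hr.2,
      boundaryIntegral_two_pi_apply hφ.analytic hr.1 hr.2] at this
  linarith

theorem IsAnalyticPosRealPart.congr {φ Φ : ℂ → Op B} (hΦ : IsAnalyticPosRealPart Φ)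
    (h : Set.EqOn φ Φ (Metric.ball 0 1)) : IsAnalyticPosRealPart φ :=
  ⟨hΦ.analytic.congr Metric.isOpen_ball h.symm, fun z hz => by rw [h hz]; exact hΦ.posReal z hz⟩

theorem IsAnalyticPosRealPart.isCaratheodoryOn {Φ : ℂ → Op B} (hΦ : IsAnalyticPosRealPart Φ)
    {φ : ℂ → Op B} {Ω : Set ℂ} (h0 : (0 : ℂ) ∈ Ω) (hΩ : Ω ⊆ Metric.ball 0 1)
    (h : Set.EqOn φ Φ Ω) : IsCaratheodoryOn φ Ω := by
  refine ⟨fun b => ?_, fun n z b hz => ?_⟩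
  · have h1 : Filter.Tendsto Φ (𝓝[Ω] 0) (𝓝 (Φ 0)) :=
      (hΦ.analytic 0 (by simp)).continuousAt.tendsto.mono_left nhdsWithin_le_nhds
    have h2 := ((evalCLM b b).continuous.tendsto (Φ 0)).comp h1
    rw [h h0]
    exact h2.congr' (eventually_nhdsWithin_of_forall fun z hz => by
      simp only [h hz]; rfl)
  · refine (hΦ.posKernel n z b fun i => hΩ (hz i)).trans_eq ?_
    simp only [kernel_apply, h (hz _)]

end Representation

end HerglotzBanach

theorem mainTheorem2 {B : Type*} [NormedAddCommGroup B] [NormedSpace ℂ B] [CompleteSpace B]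
    [TopologicalSpace.SeparableSpace B] :
    (∀ φ : ℂ → HerglotzBanach.Op B, HerglotzBanach.IsAnalyticPosRealPart φ →
      (∃ (D : HerglotzBanach.Op B) (M : ℝ → HerglotzBanach.Op B),
        HerglotzBanach.IsPurelyImaginary D ∧
        HerglotzBanach.IsIncreasingPositiveOn M 0 (2 * Real.pi) ∧
        ∀ z ∈ Metric.ball (0 : ℂ) 1, ∃ J : HerglotzBanach.Op B,
          HerglotzBanach.HasWeakStieltjesIntegral
            (fun t : ℝ => (Complex.exp (Complex.I * t) + z) / (Complex.exp (Complex.I * t) - z))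
            M 0 (2 * Real.pi) J ∧
          φ z = D + J) ∧
      HerglotzBanach.IsPositiveKernelOn (HerglotzBanach.kernel φ) (Metric.ball 0 1)) ∧
    (∀ φ : ℂ → HerglotzBanach.Op B,
      HerglotzBanach.IsAnalyticPosRealPart φ ↔
        HerglotzBanach.IsCaratheodoryOn φ (Metric.ball 0 1)) ∧
    (∀ Ω : Set ℂ, Ω ∈ nhds (0 : ℂ) → Ω ⊆ Metric.ball 0 1 → ∀ φ : ℂ → HerglotzBanach.Op B,
      HerglotzBanach.IsCaratheodoryOn φ Ω ↔
        ∃ Φ : ℂ → HerglotzBanach.Op B,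
          HerglotzBanach.IsAnalyticPosRealPart Φ ∧ Set.EqOn φ Φ Ω) := by
  refine ⟨fun φ hφ => ⟨hφ.exists_herglotz, hφ.posKernel⟩, fun φ => ⟨fun hφ => ?_, fun hφ => ?_⟩,
    fun Ω h0 hΩ φ => ⟨fun hφ => ?_, fun ⟨Φ, hΦ, h⟩ => ?_⟩⟩
  · exact hφ.isCaratheodoryOn (by simp) subset_rfl (Set.eqOn_refl _ _)
  -- With Ω the whole disk the extension agrees with φ everywhere on it, so φ inherits analyticity.
  · obtain ⟨Φ, hΦ, h⟩ := hφ.posKernel.exists_extension (by simp) subset_rfl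
    exact hΦ.congr h
  · exact hφ.posKernel.exists_extension (mem_of_mem_nhds h0) hΩ
  · exact hΦ.isCaratheodoryOn (mem_of_mem_nhds h0) hΩ h
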